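/- Let $a,b,\eta,c,\rho>0$ and $\delta>1$, and let $f$ be the probability density of a positive random variable. Let $(\Omega,\mathcal F,\mathbb F=(\mathcal F_t)_{t\ge 0},\mathbb P)$ be a filtered probability space with $\mathbb F$ complete and right-continuous, which carries an $\mathbb F$-Poisson random measure $\pi(ds,du,dz)$ on $[0,\infty)\times[0,\infty)\times\mathbb R$ with intensity $ds\,du\,f(z)\,dz$. For every $y\in[b,\infty)$ let $N^y$ be the Hawkes claim-arrival process with intensity $\lambda^y$ started at $y$, and $(Y^y_k)_{k\ge1}$ the claim sizes, all driven by $\pi$: almost surely, for all $t\ge 0$, $$d\lambda^y_t=a(b-\lambda^y_t)\,dt+\eta\,dN^y_t,\quad \lambda^y_0=y,\qquad \sum_{k=1}^{N^y_t}\delta_{Y^y_k}(dz)=\int_{s\in[0,t]}\int_{u\ge0}\mathbf 1_{\{u\le\lambda^y_{s^-}\}}\,\pi(ds,du,dz),$$ so that $N^y$ has $\mathbb F$-intensity $\lambda^y_{t^-}$ and the claim sizes are i.i.d. with density $f$, independent of $N^y$. For $x\in\mathbb R$ put $R^{x,y}_t=x+ct-\sum_{k=1}^{N^y_t}Y^y_k$.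 A strategy $\alpha=(Z,K)$ is a pair of non-decreasing $\mathbb F$-adapted processes, $Z$ càdlàg with $Z_{0^-}=0$ (cumulative dividends) and $K$ càglàd with $K_{0^-}=K_0=0$ (cumulative capital injections). Let $X_t=R^{x,y}_t-Z_t+K_t$, with $X_{0^-}=x$ and $R^{0,y}_{0^-}=0$. The set $\mathcal A(x,y)$ of admissible strategies consists of those for which, almost surely, for all $t\ge0$, $$Z_t-Z_{t^-}\le\bigl(X_{t^-}+R^{0,y}_t-R^{0,y}_{t^-}\bigr)^+.$$ Let $T^\alpha=\inf\{t\ge0:X_{t^+}<0\}$ (with $\inf\emptyset=\infty$) be the ruin time and $$J_\alpha(x,y)=\mathbb E\Bigl[\int_{[0,T^\alpha]}e^{-\rho s}\,dZ_s-\delta\int_{[0,T^\alpha)}e^{-\rho s}\,dK_s\Bigr]\in[-\infty,\infty),\qquad v(x,y)=\sup_{\alpha\in\mathcal A(x,y)}J_\alpha(x,y),$$ where the integrals over infinite horizons are over $[0,\infty)$, jumps at time $0$ are included, and $J_\alpha(x,y)=-\infty$ if the expected discounted injections are infinite. Then for every $x\ge 0$ the map $y\mapsto v(x,y)$ is non-increasing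 on $[b,\infty)$. -/

import Mathlib

open MeasureTheory ProbabilityTheory Set
open scoped NNReal ENNReal

noncomputable section

namespace HawkesDividend

/-- The value `g(t⁻)` of a path on `[0, ∞)` whose value at `0⁻` is `g₀`. -/
def preVal (g₀ : ℝ) (g : ℝ≥0 → ℝ) (t : ℝ≥0) : ℝ :=
  if t = 0 then g₀ else Function.leftLim g t

/-- The extension of a path on `[0, ∞)` to `ℝ` by the value `0` on `(-∞, 0)`, so that a positive
value at time `0` is a jump at time `0`. -/
def extendZero (g : ℝ≥0 → ℝ) (s : ℝ) : ℝ :=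
  if s < 0 then 0 else g s.toNNReal

theorem monotone_extendZero {g : ℝ≥0 → ℝ} (hg : Monotone g) (h0 : 0 ≤ g 0) :
    Monotone (extendZero g) := by
  intro s t hst
  unfold extendZero
  split_ifs with hs ht ht
  · exact le_rfl
  · exact h0.trans (hg bot_le)
  · exact absurd (lt_of_le_of_lt hst ht) hs
  · exact hg (Real.toNNReal_mono hst)

/-- Lebesgue--Stieltjes measure `dg` of a non-decreasing path on `[0, ∞)` with `g(0⁻) = 0`.
The mass of `{t}` is `g(t⁺) - g(t⁻)`. -/
def stieltjesMeasure {g : ℝ≥0 → ℝ} (hg : Monotone g) (h0 : 0 ≤ g 0) : Measure ℝ :=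
  (monotone_extendZero hg h0).stieltjesFunction.measure

variable {Ω : Type*} [mΩ : MeasurableSpace Ω]

/-- The filtration is right-continuous, and complete: its initial σ-algebra contains every
null set. -/
structure UsualConditions (𝓕 : Filtration ℝ≥0 mΩ) (P : Measure Ω) : Prop where
  rightContinuous : 𝓕.IsRightContinuous
  complete : ∀ s : Set Ω, P s = 0 → MeasurableSet[𝓕 0] s

/-- `π` is a Poisson random measure on `[0, ∞) × E` with intensity `m`, relative to the
filtration `𝓕` (the first coordinate is time). -/
structure IsPoissonRandomMeasure {E : Type*} [MeasurableSpace E] (𝓕 : Filtration ℝ≥0 mΩ)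
    (P : Measure Ω) (m : Measure (ℝ≥0 × E)) (π : Ω → Measure (ℝ≥0 × E)) : Prop where
  adapted : ∀ (t : ℝ≥0) (B : Set (ℝ≥0 × E)), MeasurableSet B → B ⊆ Iic t ×ˢ univ →
    Measurable[𝓕 t] (fun ω => π ω B)
  law : ∀ B : Set (ℝ≥0 × E), MeasurableSet B → m B ≠ ∞ →
    P.map (fun ω => π ω B) =
      (poissonMeasure (m B).toNNReal).map (fun n : ℕ => (n : ℝ≥0∞))
  indep_disjoint : ∀ (n : ℕ) (B : Fin n → Set (ℝ≥0 × E)), (∀ i, MeasurableSet (B i)) →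
    Pairwise (fun i j => Disjoint (B i) (B j)) → iIndepFun (fun i ω => π ω (B i)) P
  indep_past : ∀ t : ℝ≥0, Indep (𝓕 t)
    (⨆ B ∈ {B : Set (ℝ≥0 × E) | MeasurableSet B ∧ B ⊆ Ioi t ×ˢ univ},
      MeasurableSpace.comap (fun ω => π ω B) inferInstance) P

/-- `f` is the density of a (strictly) positive random variable. -/
structure IsPositiveDensity (f : ℝ → ℝ) : Prop where
  measurable : Measurable f
  nonneg : ∀ z, 0 ≤ f z
  eq_zero : ∀ z, z ≤ 0 → f z = 0
  lintegral_eq_one : ∫⁻ z, ENNReal.ofReal (f z) = 1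

/-- Lebesgue measure on `[0, ∞)`. -/
def lebesgueHalfLine : Measure ℝ≥0 :=
  (volume : Measure ℝ).comap (fun t : ℝ≥0 => (t : ℝ))

/-- The measure `ds ⊗ du ⊗ f(z) dz` on (time) × (level) × (claim size). -/
def claimIntensity (f : ℝ → ℝ) : Measure (ℝ≥0 × (ℝ≥0 × ℝ)) :=
  lebesgueHalfLine.prod
    (lebesgueHalfLine.prod ((volume : Measure ℝ).withDensity fun z => ENNReal.ofReal (f z)))

/-- The atoms `(s, u, z)` with `s ≤ t` and `u ≤ λ_{s⁻}`, for an intensity path `l = λ` with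
`λ_{0⁻} = y`. -/
def accepted (y : ℝ) (l : ℝ≥0 → ℝ) (t : ℝ≥0) : Set (ℝ≥0 × (ℝ≥0 × ℝ)) :=
  {p | p.1 ≤ t ∧ (p.2.1 : ℝ) ≤ preVal y l p.1}

/-- The claims process driven by `π`, with Hawkes arrivals started at intensity `y`: the counting
process `N`, its intensity `lam`, with
`dλ_t = a (b - λ_t) dt + η dN_t` and `λ_0 = y`, and the size `Y k` of the `(k + 1)`-st claim.
The claims up to time `t` are the atoms of `π` up to `t` that lie below the curve `λ_{s⁻}`:
`∑_{k < N_t} δ_{Y_k}(dz) = ∫_{s ≤ t} ∫ 1_{u ≤ λ_{s⁻}} π(ds, du, dz)`.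
In particular `N` has intensity `λ_{t⁻}` relative to `𝓕`. -/
structure HawkesClaims (𝓕 : Filtration ℝ≥0 mΩ) (P : Measure Ω)
    (π : Ω → Measure (ℝ≥0 × (ℝ≥0 × ℝ))) (a b η y : ℝ) where
  N : ℝ≥0 → Ω → ℕ
  lam : ℝ≥0 → Ω → ℝ
  Y : ℕ → Ω → ℝ
  adapted_N : ∀ t, Measurable[𝓕 t] (N t)
  adapted_lam : ∀ t, Measurable[𝓕 t] (lam t)
  measurable_Y : ∀ k, Measurable (Y k)
  adapted_claims : ∀ t, Measurable[𝓕 t] (fun ω => ∑ k ∈ Finset.range (N t ω), Y k ω)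
  counting : ∀ᵐ ω ∂P, N 0 ω = 0 ∧ Monotone (fun t => N t ω) ∧
    ∀ t, ContinuousWithinAt (fun s => N s ω) (Ici t) t
  intensity : ∀ᵐ ω ∂P, ∀ t : ℝ≥0,
    IntervalIntegrable (fun s : ℝ => lam s.toNNReal ω) volume 0 t ∧
    lam t ω = y + (∫ s in (0 : ℝ)..t, a * (b - lam s.toNNReal ω)) + η * N t ω
  thinning : ∀ᵐ ω ∂P, ∀ t : ℝ≥0,
    ((π ω).restrict (accepted y (fun s => lam s ω) t)).map (fun p => p.2.2) =
      ∑ k ∈ Finset.range (N t ω), Measure.dirac (Y k ω)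

/-- Uncontrolled reserve with initial capital `x`: `R^x_t = x + c t - ∑_{k ≤ N_t} Y_k`. -/
def HawkesClaims.reserve {𝓕 : Filtration ℝ≥0 mΩ} {P : Measure Ω}
    {π : Ω → Measure (ℝ≥0 × (ℝ≥0 × ℝ))} {a b η y : ℝ} (H : HawkesClaims 𝓕 P π a b η y)
    (c x : ℝ) (t : ℝ≥0) (ω : Ω) : ℝ :=
  x + c * t - ∑ k ∈ Finset.range (H.N t ω), H.Y k ω

/-- A pair `(Z, K)` of `𝓕`-adapted non-decreasing processes, `Z` (cumulative dividends) càdlàg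
with `Z_{0⁻} = 0`, and `K` (cumulative capital injections) càglàd with `K_{0⁻} = K_0 = 0`. -/
structure Control (𝓕 : Filtration ℝ≥0 mΩ) where
  Z : ℝ≥0 → Ω → ℝ
  K : ℝ≥0 → Ω → ℝ
  adapted_Z : ∀ t, Measurable[𝓕 t] (Z t)
  adapted_K : ∀ t, Measurable[𝓕 t] (K t)
  mono_Z : ∀ ω, Monotone fun t => Z t ω
  mono_K : ∀ ω, Monotone fun t => K t ω
  rightCont_Z : ∀ ω t, ContinuousWithinAt (fun s => Z s ω) (Ici t) t
  leftCont_K : ∀ ω t, ContinuousWithinAt (fun s => K s ω) (Iic t) t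
  zero_le_Z : ∀ ω, 0 ≤ Z 0 ω
  K_zero : ∀ ω, K 0 ω = 0

namespace Control

variable {𝓕 : Filtration ℝ≥0 mΩ} {P : Measure Ω} {π : Ω → Measure (ℝ≥0 × (ℝ≥0 × ℝ))}
  {a b η y : ℝ}

/-- Controlled surplus `X_t = R^x_t - Z_t + K_t`. -/
def surplus (α : Control 𝓕) (H : HawkesClaims 𝓕 P π a b η y) (c x : ℝ) (t : ℝ≥0) (ω : Ω) : ℝ :=
  H.reserve c x t ω - α.Z t ω + α.K t ω

/-- Dividends are paid out of the available reserve: almost surely, for all `t`,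
`Z_t - Z_{t⁻} ≤ (X_{t⁻} + R^0_t - R^0_{t⁻})⁺`, with `Z_{0⁻} = 0`, `X_{0⁻} = x`, `R^0_{0⁻} = 0`. -/
def Admissible (α : Control 𝓕) (H : HawkesClaims 𝓕 P π a b η y) (c x : ℝ) : Prop :=
  ∀ᵐ ω ∂P, ∀ t : ℝ≥0,
    α.Z t ω - preVal 0 (fun s => α.Z s ω) t ≤
      max 0 (preVal x (fun s => α.surplus H c x s ω) t +
        (H.reserve c 0 t ω - preVal 0 (fun s => H.reserve c 0 s ω) t))

/-- Ruin time `T = inf {t ≥ 0 | X_{t⁺} < 0}`, with `inf ∅ = ∞`. -/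
def ruinTime (α : Control 𝓕) (H : HawkesClaims 𝓕 P π a b η y) (c x : ℝ) (ω : Ω) : ℝ≥0∞ :=
  ⨅ (t : ℝ≥0) (_ : Function.rightLim (fun s => α.surplus H c x s ω) t < 0), (t : ℝ≥0∞)

/-- Discounted dividends `∫_{[0, T]} e^{-ρ s} dZ_s`. -/
def discountedDividends (α : Control 𝓕) (H : HawkesClaims 𝓕 P π a b η y) (c ρ x : ℝ) (ω : Ω) :
    ℝ≥0∞ :=
  ∫⁻ s in {s : ℝ | 0 ≤ s ∧ ENNReal.ofReal s ≤ α.ruinTime H c x ω},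
    ENNReal.ofReal (Real.exp (-ρ * s)) ∂(stieltjesMeasure (α.mono_Z ω) (α.zero_le_Z ω))

/-- Discounted injections `∫_{[0, T)} e^{-ρ s} dK_s`; as `K` is left-continuous, the increment of
`K` up to time `T` is its mass on `[0, T)`. -/
def discountedInjections (α : Control 𝓕) (H : HawkesClaims 𝓕 P π a b η y) (c ρ x : ℝ) (ω : Ω) :
    ℝ≥0∞ :=
  ∫⁻ s in {s : ℝ | 0 ≤ s ∧ ENNReal.ofReal s < α.ruinTime H c x ω},
    ENNReal.ofReal (Real.exp (-ρ * s)) ∂(stieltjesMeasure (α.mono_K ω) (α.K_zero ω).ge)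

/-- Reward `J_α(x, y) = E[∫ e^{-ρ s} dZ_s - δ ∫ e^{-ρ s} dK_s]`, in `[-∞, ∞]`. For an admissible
control and `δ > 1` the integrand is bounded above by a constant, and `J_α = -∞` exactly when the
expected discounted injections are infinite (in `EReal`, `⊤ - ⊤ = ⊥`). -/
def reward (α : Control 𝓕) (H : HawkesClaims 𝓕 P π a b η y) (c ρ δ x : ℝ) : EReal :=
  ((∫⁻ ω, α.discountedDividends H c ρ x ω ∂P : ℝ≥0∞) : EReal) -
    ((ENNReal.ofReal δ * ∫⁻ ω, α.discountedInjections H c ρ x ω ∂P : ℝ≥0∞) : EReal)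

end Control

/-- Value function `v(x, y) = sup {J_α(x, y) | α admissible}`; `y` is the initial intensity
of `H`. -/
def valueFunction {𝓕 : Filtration ℝ≥0 mΩ} {P : Measure Ω}
    {π : Ω → Measure (ℝ≥0 × (ℝ≥0 × ℝ))} {a b η y : ℝ} (H : HawkesClaims 𝓕 P π a b η y)
    (c ρ δ x : ℝ) : EReal :=
  ⨆ (α : Control 𝓕) (_ : α.Admissible H c x), α.reward H c ρ δ x

end HawkesDividend

end

open Filter Topology

namespace HawkesDividend

/-! Both claim processes are read off the same atoms of `π`, so the comparison is pathwise. For `y ≤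
y'` the intensity curve from `y` stays below the one from `y'` (`IsClaimPath.intensity_le`): while
the order holds, every atom accepted by the lower curve is accepted by the upper one, so jumps can
only widen the gap, and between jumps the gap solves a linear ODE. Claims are positive, so total
claims are ordered (`IsClaimPath.sum_claims_le`), and the reserve from `y` dominates the reserve
from `y'`.

A larger reserve is worth at least as much (`valueFunction_le_of_reserve_le`). Take a control
admissible for `y'`, stop it at its own ruin time `T`, and use it for `y`. It stays admissible, ruin
comes no earlier than `T`, all dividends on `[0, T]` are still paid, and at most the injections on
`[0, T)` are charged. Without stopping, injections after `T` would be charged while the larger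
reserve survives. The technical part is that the stopped pair is adapted and has the restricted
Stieltjes measures. -/

/-! ### Pathwise comparison of claim paths driven by the same atoms. -/

theorem eventually_nhdsLT_eq_of_monotone_nat {N : ℝ≥0 → ℕ} (hN : Monotone N) {t : ℝ≥0}
    (ht : 0 < t) : ∃ n, ∀ᶠ s in 𝓝[<] t, N s = n := by
  have hbdd : BddAbove (N '' Iio t) := ⟨N t, by rintro _ ⟨s, hs, rfl⟩; exact hN (le_of_lt hs)⟩
  -- A bounded set of naturals attains its supremum, so `N` is constant on `(s₀, t)`.
  obtain ⟨s₀, hs₀, hmax⟩ := Nat.sSup_mem (s := N '' Iio t) ⟨N 0, 0, ht, rfl⟩ hbdd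
  refine ⟨N s₀, ?_⟩
  filter_upwards [Ioo_mem_nhdsLT (show s₀ < t from hs₀)] with s hs
  exact le_antisymm (hmax ▸ le_csSup hbdd ⟨s, hs.2, rfl⟩) (hN hs.1.le)

theorem eventually_nhdsGE_eq_of_continuousWithinAt_nat {N : ℝ≥0 → ℕ} {t : ℝ≥0}
    (hN : ContinuousWithinAt N (Ici t) t) : ∀ᶠ s in 𝓝[≥] t, N s = N t := by
  have h := hN
  rw [ContinuousWithinAt, nhds_discrete, tendsto_pure] at h
  exact h

/-- A realisation of the claims process: arrivals `N`, intensity `l`, claim sizes `Y`, driven by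
the point configuration `μ`. -/
structure IsClaimPath (μ : Measure (ℝ≥0 × (ℝ≥0 × ℝ))) (a b η y : ℝ) (N : ℝ≥0 → ℕ)
    (l : ℝ≥0 → ℝ) (Y : ℕ → ℝ) : Prop where
  N_zero : N 0 = 0
  mono : Monotone N
  rightCont : ∀ t, ContinuousWithinAt N (Ici t) t
  integrable : ∀ t : ℝ≥0, IntervalIntegrable (fun s : ℝ => l s.toNNReal) volume 0 t
  intensity : ∀ t : ℝ≥0, l t = y + (∫ s in (0 : ℝ)..t, a * (b - l s.toNNReal)) + η * N t
  thinning : ∀ t : ℝ≥0, (μ.restrict (accepted y l t)).map (fun p => p.2.2) =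
      ∑ k ∈ Finset.range (N t), Measure.dirac (Y k)

theorem accepted_inter_Iic (y : ℝ) (l : ℝ≥0 → ℝ) {r t : ℝ≥0} (hrt : r ≤ t) :
    accepted y l t ∩ Iic r ×ˢ univ = accepted y l r := by
  ext p
  simp only [accepted, mem_inter_iff, mem_ofPred_eq, mem_prod, mem_Iic, mem_univ, and_true]
  exact ⟨fun h => ⟨h.2, h.1.2⟩, fun h => ⟨⟨h.1.trans hrt, h.2⟩, h.1⟩⟩

namespace IsClaimPath

variable {μ : Measure (ℝ≥0 × (ℝ≥0 × ℝ))} {a b η y y' : ℝ} {N N' : ℝ≥0 → ℕ} {l l' : ℝ≥0 → ℝ}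
  {Y Y' : ℕ → ℝ}

theorem intervalIntegrable (h : IsClaimPath μ a b η y N l Y) (s t : ℝ) :
    IntervalIntegrable (fun s : ℝ => l s.toNNReal) volume s t := by
  have key : ∀ t : ℝ, IntervalIntegrable (fun s : ℝ => l s.toNNReal) volume 0 t := by
    intro t
    rcases le_total 0 t with ht | ht
    · simpa [Real.coe_toNNReal t ht] using h.integrable t.toNNReal
    · refine (intervalIntegrable_const (c := l 0)).congr ?_
      intro s hs
      rw [uIoc_of_ge ht] at hs
      simp [Real.toNNReal_of_nonpos hs.2]
  exact (key s).symm.trans (key t)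

theorem continuous_drift (h : IsClaimPath μ a b η y N l Y) :
    Continuous fun t : ℝ≥0 => ∫ s in (0 : ℝ)..t, a * (b - l s.toNNReal) :=
  (intervalIntegral.continuous_primitive
    (fun s t => (intervalIntegrable_const.sub (h.intervalIntegrable s t)).const_mul a) 0).comp
    NNReal.continuous_coe

/-- `Function.leftLim` falls back to the value at `t` when no limit exists, so existence must be
shown: the drift is continuous and `N` is eventually constant to the left of `t`. -/
theorem tendsto_leftLim (h : IsClaimPath μ a b η y N l Y) {t : ℝ≥0} (ht : 0 < t) :
    Tendsto l (𝓝[<] t) (𝓝 (Function.leftLim l t)) := by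
  refine tendsto_leftLim_of_tendsto ?_
  obtain ⟨n, hn⟩ := eventually_nhdsLT_eq_of_monotone_nat h.mono ht
  refine ⟨y + (∫ s in (0 : ℝ)..t, a * (b - l s.toNNReal)) + η * n, ?_⟩
  have hc := (h.continuous_drift.tendsto t).mono_left (nhdsWithin_le_nhds (s := Iio t))
  refine ((hc.const_add y).add_const (η * n)).congr' ?_
  filter_upwards [hn] with s hs
  rw [h.intensity s, hs]

theorem measure_accepted (h : IsClaimPath μ a b η y N l Y) (t : ℝ≥0) :
    μ (accepted y l t) = N t := by
  have e : ((μ.restrict (accepted y l t)).map (fun p => p.2.2)) univ = N t := by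
    rw [h.thinning t]
    simp
  rwa [Measure.map_apply (by fun_prop) MeasurableSet.univ, preimage_univ,
    Measure.restrict_apply_univ] at e

/-- Atoms in `(r, t]` below the lower curve lie below the upper one, so `N' - N` grows from `r` to
`t`; the additive form avoids truncated subtraction. -/
theorem arrivals_increment_le (h : IsClaimPath μ a b η y N l Y)
    (h' : IsClaimPath μ a b η y' N' l' Y') {r t : ℝ≥0} (hrt : r ≤ t)
    (hl : ∀ p ≤ t, preVal y l p ≤ preVal y' l' p) : N t + N' r ≤ N' t + N r := by
  -- The accepted sets are split along this slab, so only the slab has to be measurable.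
  have hm : MeasurableSet (Iic r ×ˢ univ : Set (ℝ≥0 × (ℝ≥0 × ℝ))) :=
    measurableSet_Iic.prod MeasurableSet.univ
  have e := measure_inter_add_sdiff (μ := μ) (accepted y l t) hm
  have e' := measure_inter_add_sdiff (μ := μ) (accepted y' l' t) hm
  rw [accepted_inter_Iic y l hrt, h.measure_accepted, h.measure_accepted] at e
  rw [accepted_inter_Iic y' l' hrt, h'.measure_accepted, h'.measure_accepted] at e'
  have hsub : μ (accepted y l t \ Iic r ×ˢ univ) ≤ μ (accepted y' l' t \ Iic r ×ˢ univ) :=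
    measure_mono (sdiff_subset_sdiff_left fun p hp => ⟨hp.1, hp.2.trans (hl _ hp.1)⟩)
  have : ((N t + N' r : ℕ) : ℝ≥0∞) ≤ ((N' t + N r : ℕ) : ℝ≥0∞) := by
    push_cast
    rw [← e, ← e']
    calc _ = (N r : ℝ≥0∞) + N' r + μ (accepted y l t \ Iic r ×ˢ univ) := by ring
      _ ≤ (N r : ℝ≥0∞) + N' r + μ (accepted y' l' t \ Iic r ×ˢ univ) := by gcongr
      _ = _ := by ring
  exact_mod_cast this

theorem preVal_le (h : IsClaimPath μ a b η y N l Y) (h' : IsClaimPath μ a b η y' N' l' Y')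
    (hy : y ≤ y') {t : ℝ≥0} (hl : ∀ s < t, l s ≤ l' s) : preVal y l t ≤ preVal y' l' t := by
  unfold preVal
  split_ifs with ht
  · exact hy
  · have ht : 0 < t := pos_iff_ne_zero.2 ht
    have : (𝓝[<] t).NeBot := nhdsLT_neBot_of_exists_lt ⟨0, ht⟩
    exact le_of_tendsto_of_tendsto (h.tendsto_leftLim ht) (h'.tendsto_leftLim ht)
      (eventually_nhdsWithin_of_forall hl)

theorem intensity_sub (h : IsClaimPath μ a b η y N l Y) (h' : IsClaimPath μ a b η y' N' l' Y')
    (t : ℝ≥0) : l' t - l t = (y' - y) -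
      a * (∫ s in (0 : ℝ)..t, (l' s.toNNReal - l s.toNNReal)) + η * ((N' t : ℝ) - N t) := by
  rw [h.intensity t, h'.intensity t]
  have i := h.integrable t
  have i' := h'.integrable t
  rw [intervalIntegral.integral_const_mul, intervalIntegral.integral_const_mul,
    intervalIntegral.integral_sub intervalIntegrable_const i,
    intervalIntegral.integral_sub intervalIntegrable_const i',
    intervalIntegral.integral_sub i' i]
  ring

/-- Pathwise comparison: the intensity is monotone in its initial value. -/
theorem intensity_le (h : IsClaimPath μ a b η y N l Y) (h' : IsClaimPath μ a b η y' N' l' Y')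
    (ha : 0 ≤ a) (hη : 0 ≤ η) (hy : y ≤ y') (t : ℝ≥0) : l t ≤ l' t := by
  set F : ℝ≥0 → ℝ := fun t => ∫ s in (0 : ℝ)..t, (l' s.toNNReal - l s.toNNReal) with hF
  have hFc : Continuous F := (intervalIntegral.continuous_primitive
    (fun s t => (h'.intervalIntegrable s t).sub (h.intervalIntegrable s t)) 0).comp
    NNReal.continuous_coe
  have hd : ∀ t, l' t - l t = (y' - y) - a * F t + η * ((N' t : ℝ) - N t) := h.intensity_sub h'
  by_contra! hneg
  set S : Set ℝ≥0 := {t | l' t < l t} with hS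
  have hSne : S.Nonempty := ⟨t, hneg⟩
  set τ := sInf S with hτ
  have hbefore : ∀ s < τ, l s ≤ l' s := fun s hs =>
    not_lt.1 fun hlt => (notMem_of_lt_csInf hs (OrderBot.bddBelow S)) hlt
  -- Acceptance at `τ` depends on left limits only, so order strictly before `τ` controls arrivals
  -- up to and including `τ`.
  have hincr : ∀ r ≤ τ, N τ + N' r ≤ N' τ + N r := fun r hr =>
    h.arrivals_increment_le h' hr fun p hp =>
      h.preVal_le h' hy fun s hs => hbefore s (hs.trans_le hp)
  -- The order survives at `τ`: the integral term is continuous and the jump of `N' - N` there is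
  -- nonnegative.
  have hτnonneg : 0 ≤ l' τ - l τ := by
    rcases eq_or_ne τ 0 with h0 | h0
    · rw [h0, hd 0]
      simp [hF, h.N_zero, h'.N_zero, hy]
    · have h0 : 0 < τ := pos_iff_ne_zero.2 h0
      have : (𝓝[<] τ).NeBot := nhdsLT_neBot_of_exists_lt ⟨0, h0⟩
      have hlim : Tendsto (fun r => a * F r - a * F τ) (𝓝[<] τ) (𝓝 0) := by
        have := ((hFc.tendsto τ).mono_left (nhdsWithin_le_nhds (s := Iio τ))).const_mul a
        simpa using this.sub_const (a * F τ)
      refine le_of_tendsto hlim (eventually_nhdsWithin_of_forall fun r hr => ?_)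
      have h1 : (N τ : ℝ) + N' r ≤ N' τ + N r := by exact_mod_cast hincr r (le_of_lt hr)
      have h2 : η * ((N' r : ℝ) - N r) ≤ η * ((N' τ : ℝ) - N τ) :=
        mul_le_mul_of_nonneg_left (by linarith) hη
      have h3 := hbefore r hr
      have h4 := hd r
      rw [hd τ]
      linarith
  -- Just after `τ` neither process jumps, so up to a violation time `u` the gap is an affine
  -- function of the continuous `F`.
  obtain ⟨ε, hε, hconst⟩ := (mem_nhdsGE_iff_exists_Ico_subset' (show τ < τ + 1 by simp)).1
    ((eventually_nhdsGE_eq_of_continuousWithinAt_nat (h.rightCont τ)).and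
      (eventually_nhdsGE_eq_of_continuousWithinAt_nat (h'.rightCont τ)))
  obtain ⟨u, hu, huε⟩ := exists_lt_of_csInf_lt hSne (show sInf S < ε from hε)
  have hτu : τ ≤ u := csInf_le (OrderBot.bddBelow S) hu
  have hd' : ∀ s ∈ Icc τ u, l' s - l s = (l' τ - l τ) - a * (F s - F τ) := by
    intro s hs
    have hh := hconst ⟨hs.1, hs.2.trans_lt huε⟩
    rw [hd s, hd τ, hh.1, hh.2]
    ring
  have hcomp : IsCompact (Icc τ u ∩ {s | 0 ≤ (l' τ - l τ) - a * (F s - F τ)}) :=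
    isCompact_Icc.inter_right (isClosed_le continuous_const (by fun_prop))
  -- `σ` is the last time in `[τ, u]` with nonnegative gap. After it the gap is nonpositive, so `F`
  -- does not increase, and mean reversion gives a gap at `u` at least that at `σ`: a contradiction.
  obtain ⟨σ, ⟨hσ, hσ0⟩, hσmax⟩ := hcomp.exists_isGreatest
    ⟨τ, left_mem_Icc.2 hτu, by simpa using hτnonneg⟩
  have hafter : ∀ s ∈ Ioc σ u, l' s - l s ≤ 0 := by
    intro s hs
    by_contra! hpos
    have hmem : s ∈ Icc τ u := ⟨hσ.1.trans hs.1.le, hs.2⟩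
    exact absurd (hσmax ⟨hmem, by rw [hd' s hmem] at hpos; exact hpos.le⟩) (not_le.2 hs.1)
  have hFle : F u ≤ F σ := by
    have hσu : (σ : ℝ) ≤ u := by exact_mod_cast hσ.2
    have e : F u - F σ = ∫ s in (σ : ℝ)..u, (l' s.toNNReal - l s.toNNReal) :=
      intervalIntegral.integral_interval_sub_left
        ((h'.intervalIntegrable _ _).sub (h.intervalIntegrable _ _))
        ((h'.intervalIntegrable _ _).sub (h.intervalIntegrable _ _))
    have : ∫ s in (σ : ℝ)..u, (l' s.toNNReal - l s.toNNReal) ≤ 0 := by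
      rw [intervalIntegral.integral_of_le hσu]
      refine setIntegral_nonpos measurableSet_Ioc fun s hs => hafter _ ⟨?_, ?_⟩
      · rw [← NNReal.coe_lt_coe, Real.coe_toNNReal s (σ.2.trans hs.1.le)]; exact hs.1
      · rw [← NNReal.coe_le_coe, Real.coe_toNNReal s (σ.2.trans hs.1.le)]; exact hs.2
    linarith
  have hu0 : l' u - l u < 0 := sub_neg.2 hu
  have h5 := hd' u ⟨hτu, le_rfl⟩
  have h6 : a * F u ≤ a * F σ := mul_le_mul_of_nonneg_left hFle ha
  have h7 : 0 ≤ (l' τ - l τ) - a * (F σ - F τ) := hσ0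
  linarith

/-- A nonpositive claim would be a Dirac mass of the image measure on `Iic 0`, where `μ` puts none.
-/
theorem claim_pos (h : IsClaimPath μ a b η y N l Y) (hμ : μ {p | p.2.2 ≤ 0} = 0) {t : ℝ≥0}
    {k : ℕ} (hk : k < N t) : 0 < Y k := by
  by_contra! hneg
  have e : ((μ.restrict (accepted y l t)).map (fun p => p.2.2)) (Iic 0) = 0 := by
    rw [Measure.map_apply (by fun_prop) measurableSet_Iic]
    exact le_antisymm ((Measure.restrict_apply_le _ _).trans hμ.le) bot_le
  rw [h.thinning t, Measure.finsetSum_apply] at e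
  have := (Finset.sum_eq_zero_iff.1 e) k (Finset.mem_range.2 hk)
  simp [hneg] at this

/-- The two paths number their claims differently; as integrals over accepted sets the totals are
compared by inclusion alone. -/
theorem ofReal_sum_claims (h : IsClaimPath μ a b η y N l Y) (hμ : μ {p | p.2.2 ≤ 0} = 0)
    (t : ℝ≥0) : ENNReal.ofReal (∑ k ∈ Finset.range (N t), Y k) =
      ∫⁻ p in accepted y l t, ENNReal.ofReal p.2.2 ∂μ := by
  rw [← lintegral_map (g := fun p : ℝ≥0 × (ℝ≥0 × ℝ) => p.2.2) ENNReal.measurable_ofReal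
    (measurable_snd.comp measurable_snd), h.thinning t, lintegral_finsetSum_measure,
    ENNReal.ofReal_sum_of_nonneg fun k hk => (h.claim_pos hμ (Finset.mem_range.1 hk)).le]
  simp

theorem sum_claims_le (h : IsClaimPath μ a b η y N l Y) (h' : IsClaimPath μ a b η y' N' l' Y')
    (ha : 0 ≤ a) (hη : 0 ≤ η) (hy : y ≤ y') (hμ : μ {p | p.2.2 ≤ 0} = 0) (t : ℝ≥0) :
    ∑ k ∈ Finset.range (N t), Y k ≤ ∑ k ∈ Finset.range (N' t), Y' k := by
  rw [← ENNReal.ofReal_le_ofReal_iff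
    (Finset.sum_nonneg fun k hk => (h'.claim_pos hμ (Finset.mem_range.1 hk)).le),
    h.ofReal_sum_claims hμ, h'.ofReal_sum_claims hμ]
  exact lintegral_mono_set fun p hp =>
    ⟨hp.1, hp.2.trans (h.preVal_le h' hy fun s _ => h.intensity_le h' ha hη hy s)⟩

end IsClaimPath

/-! ### Almost sure properties of the claims and of the Poisson atoms. -/

theorem HawkesClaims.ae_isClaimPath {Ω : Type*} [mΩ : MeasurableSpace Ω]
    {𝓕 : Filtration ℝ≥0 mΩ} {P : Measure Ω}
    {π : Ω → Measure (ℝ≥0 × (ℝ≥0 × ℝ))} {a b η y : ℝ} (H : HawkesClaims 𝓕 P π a b η y) :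
    ∀ᵐ ω ∂P, IsClaimPath (π ω) a b η y (fun t => H.N t ω) (fun t => H.lam t ω)
      (fun k => H.Y k ω) := by
  filter_upwards [H.counting, H.intensity, H.thinning] with ω h1 h2 h3
  exact ⟨h1.1, h1.2.1, h1.2.2, fun t => (h2 t).1, fun t => (h2 t).2, h3⟩

theorem IsPoissonRandomMeasure.ae_eq_zero {Ω : Type*} [mΩ : MeasurableSpace Ω] {E : Type*}
    [MeasurableSpace E] {𝓕 : Filtration ℝ≥0 mΩ} {P : Measure Ω} {m : Measure (ℝ≥0 × E)}
    {π : Ω → Measure (ℝ≥0 × E)} (hπ : IsPoissonRandomMeasure 𝓕 P m π) {B : Set (ℝ≥0 × E)}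
    (hB : MeasurableSet B) (hm : m B = 0) : ∀ᵐ ω ∂P, π ω B = 0 := by
  have key : ∀ n : ℕ, ∀ᵐ ω ∂P, π ω (B ∩ Iic (n : ℝ≥0) ×ˢ univ) = 0 := by
    intro n
    -- Measurability of `π ω B` is provided only for sets bounded in time.
    set C := B ∩ Iic (n : ℝ≥0) ×ˢ univ
    have hC : MeasurableSet C := hB.inter (measurableSet_Iic.prod MeasurableSet.univ)
    have hmC : m C = 0 := measure_mono_null inter_subset_left hm
    have hmeas : Measurable fun ω => π ω C :=
      (hπ.adapted n C hC inter_subset_right).mono (𝓕.le _) le_rfl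
    have e := congrArg (fun ν => ν {0}ᶜ) (hπ.law C hC (by simp [hmC]))
    simp only [Measure.map_apply hmeas (measurableSet_singleton (0 : ℝ≥0∞)).compl,
      Measure.map_apply (measurable_from_nat) (measurableSet_singleton (0 : ℝ≥0∞)).compl, hmC] at e
    rw [ae_iff]
    refine e.trans ?_
    rw [poissonMeasure, Measure.sum_apply _ (MeasurableSet.of_discrete)]
    refine ENNReal.tsum_eq_zero.2 fun k => ?_
    rcases eq_or_ne k 0 with rfl | hk <;> simp [*]
  filter_upwards [ae_all_iff.2 key] with ω hω
  refine measure_mono_null (fun p hp => ?_) (measure_iUnion_null hω)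
  obtain ⟨n, hn⟩ := exists_nat_ge p.1
  exact mem_iUnion.2 ⟨n, hp, hn, trivial⟩

theorem claimIntensity_nonpos {f : ℝ → ℝ} (hf : IsPositiveDensity f) :
    claimIntensity f {p | p.2.2 ≤ 0} = 0 := by
  have e : {p : ℝ≥0 × (ℝ≥0 × ℝ) | p.2.2 ≤ 0} = univ ×ˢ (univ ×ˢ Iic 0) := by
    ext p; simp
  have h0 : ((volume : Measure ℝ).withDensity fun z => ENNReal.ofReal (f z)) (Iic 0) = 0 := by
    rw [withDensity_apply _ measurableSet_Iic]
    refine (setLIntegral_congr_fun measurableSet_Iic fun z hz => ?_).trans lintegral_zero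
    simp [hf.eq_zero z hz]
  have : SigmaFinite lebesgueHalfLine := by
    have hcoe : MeasurableEmbedding ((↑) : ℝ≥0 → ℝ) :=
      MeasurableEmbedding.subtype_coe measurableSet_Ici
    refine SigmaFinite.of_map _ hcoe.measurable.aemeasurable ?_
    rw [lebesgueHalfLine, hcoe.map_comap]
    infer_instance
  rw [e, claimIntensity, Measure.prod_prod, Measure.prod_prod, h0]
  simp

/-! ### Stopping a path and its Stieltjes measure. -/

/-- The time `t` stopped at the (possibly infinite) time `T`. -/
noncomputable def clip (T : ℝ≥0∞) (t : ℝ≥0) : ℝ≥0 := (min (t : ℝ≥0∞) T).toNNReal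

theorem clip_top (t : ℝ≥0) : clip ∞ t = t := by simp [clip]

theorem clip_coe (r t : ℝ≥0) : clip r t = min t r := by
  rw [clip, ← ENNReal.coe_min, ENNReal.toNNReal_coe]

theorem clip_of_le {T : ℝ≥0∞} {t : ℝ≥0} (h : t ≤ T) : clip T t = t := by simp [clip, h]

theorem clip_of_ge {T : ℝ≥0∞} {t : ℝ≥0} (h : T ≤ t) : clip T t = T.toNNReal := by simp [clip, h]

theorem monotone_clip (T : ℝ≥0∞) : Monotone (clip T) := fun _ _ hst =>
  ENNReal.toNNReal_mono (ne_top_of_le_ne_top ENNReal.coe_ne_top (min_le_left _ _))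
    (min_le_min_right _ (ENNReal.coe_le_coe.2 hst))

theorem continuous_clip (T : ℝ≥0∞) : Continuous (clip T) := by
  induction T with
  | top =>
    rw [funext clip_top]
    exact continuous_id
  | coe r =>
    simp only [funext (clip_coe r)]
    fun_prop

theorem extendZero_comp_clip (g : ℝ≥0 → ℝ) (r : ℝ≥0) (s : ℝ) :
    extendZero (g ∘ clip r) s = extendZero g (min s r) := by
  unfold extendZero
  by_cases hs : s < 0
  · simp [hs]
  · have : ¬ min s (r : ℝ) < 0 := by simpa using hs
    rw [if_neg hs, if_neg this, Function.comp_apply, clip_coe]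
    congr 1
    rw [← NNReal.coe_inj, Real.coe_toNNReal _ (not_lt.1 this), NNReal.coe_min,
      Real.coe_toNNReal _ (not_lt.1 hs)]

theorem coe_stieltjesFunction {f : ℝ → ℝ} (hf : Monotone f) :
    (hf.stieltjesFunction : ℝ → ℝ) = Function.rightLim f :=
  funext hf.stieltjesFunction_eq

theorem continuousWithinAt_Ici_extendZero {g : ℝ≥0 → ℝ}
    (hg : ∀ t, ContinuousWithinAt g (Ici t) t) (s : ℝ) :
    ContinuousWithinAt (extendZero g) (Ici s) s := by
  rcases lt_or_ge s 0 with hs | hs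
  · refine (continuousAt_const (y := (0 : ℝ))).continuousWithinAt.congr_of_eventuallyEq ?_ ?_
    · filter_upwards [nhdsWithin_le_nhds (Iio_mem_nhds hs)] with u hu
      exact if_pos hu
    · exact if_pos hs
  · have : ContinuousWithinAt (g ∘ Real.toNNReal) (Ici s) s :=
      (hg s.toNNReal).comp continuous_real_toNNReal.continuousWithinAt
        fun u hu => Real.toNNReal_mono hu
    exact this.congr (fun u hu => if_neg (not_lt.2 (hs.trans hu))) (if_neg (not_lt.2 hs))

theorem continuousWithinAt_Iic_extendZero {g : ℝ≥0 → ℝ}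
    (hg : ∀ t, ContinuousWithinAt g (Iic t) t) (h0 : g 0 = 0) (s : ℝ) :
    ContinuousWithinAt (extendZero g) (Iic s) s := by
  have e : extendZero g = g ∘ Real.toNNReal := by
    funext u
    unfold extendZero
    split_ifs with hu
    · simp [Real.toNNReal_of_nonpos hu.le, h0]
    · rfl
  rw [e]
  exact (hg s.toNNReal).comp continuous_real_toNNReal.continuousWithinAt
    fun u hu => Real.toNNReal_mono hu

theorem stieltjesMeasure_Ioc {g : ℝ≥0 → ℝ} (hg : Monotone g) (h0 : 0 ≤ g 0)
    (hc : ∀ t, ContinuousWithinAt g (Ici t) t) (u v : ℝ) :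
    stieltjesMeasure hg h0 (Ioc u v) = ENNReal.ofReal (extendZero g v - extendZero g u) := by
  rw [stieltjesMeasure, StieltjesFunction.measure_Ioc, coe_stieltjesFunction,
    (continuousWithinAt_Ici_extendZero hc u).rightLim_eq,
    (continuousWithinAt_Ici_extendZero hc v).rightLim_eq]

/-- The measure is built from the right limits of `g`, whose left limits are again `g` when `g` is
càglàd; hence `[u, v)` here, against `(u, v]` for càdlàg paths. -/
theorem stieltjesMeasure_Ico {g : ℝ≥0 → ℝ} (hg : Monotone g) (h0 : g 0 = 0)
    (hc : ∀ t, ContinuousWithinAt g (Iic t) t) (u v : ℝ) :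
    stieltjesMeasure hg h0.ge (Ico u v) = ENNReal.ofReal (extendZero g v - extendZero g u) := by
  have hm := monotone_extendZero hg h0.ge
  rw [stieltjesMeasure, StieltjesFunction.measure_Ico, coe_stieltjesFunction,
    leftLim_rightLim (hm.tendsto_leftLim u), leftLim_rightLim (hm.tendsto_leftLim v),
    (continuousWithinAt_Iic_extendZero hc h0 u).leftLim_eq,
    (continuousWithinAt_Iic_extendZero hc h0 v).leftLim_eq]

instance {g : ℝ≥0 → ℝ} (hg : Monotone g) (h0 : 0 ≤ g 0) :
    IsLocallyFiniteMeasure (stieltjesMeasure hg h0) := by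
  unfold stieltjesMeasure
  infer_instance

theorem stieltjesMeasure_congr {g h : ℝ≥0 → ℝ} (hg : Monotone g) (h0 : 0 ≤ g 0)
    (hh : Monotone h) (h0' : 0 ≤ h 0) (e : g = h) :
    stieltjesMeasure hg h0 = stieltjesMeasure hh h0' := by
  subst e
  rfl

/-- Stopping a càdlàg path at `T` restricts its Stieltjes measure to `[0, T]`. -/
theorem stieltjesMeasure_comp_clip_of_rightCont {g : ℝ≥0 → ℝ} (hg : Monotone g) (h0 : 0 ≤ g 0)
    (hc : ∀ t, ContinuousWithinAt g (Ici t) t) (T : ℝ≥0∞) (hg' : Monotone (g ∘ clip T))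
    (h0' : 0 ≤ (g ∘ clip T) 0) (hc' : ∀ t, ContinuousWithinAt (g ∘ clip T) (Ici t) t) :
    stieltjesMeasure hg' h0' = (stieltjesMeasure hg h0).restrict {s | ENNReal.ofReal s ≤ T} := by
  induction T with
  | top =>
    have e : g ∘ clip ∞ = g := by rw [funext clip_top]; rfl
    simpa using stieltjesMeasure_congr _ _ _ _ e
  | coe r =>
    have e : {s : ℝ | ENNReal.ofReal s ≤ r} = Iic (r : ℝ) := by
      ext s
      simp [ENNReal.ofReal, ← Real.toNNReal_le_iff_le_coe]
    rw [e]
    refine Measure.ext_of_Ioc _ _ fun u v _ => ?_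
    rw [Measure.restrict_apply measurableSet_Ioc, Ioc_inter_Iic,
      stieltjesMeasure_Ioc hg' h0' hc', stieltjesMeasure_Ioc hg h0 hc, extendZero_comp_clip,
      extendZero_comp_clip]
    rcases le_total u r with hu | hu
    · rw [min_eq_left hu]
    · rw [min_eq_right hu, ENNReal.ofReal_of_nonpos, ENNReal.ofReal_of_nonpos]
      · exact sub_nonpos.2 (monotone_extendZero hg h0 ((min_le_right _ _).trans hu))
      · exact sub_nonpos.2 (monotone_extendZero hg h0 (min_le_right _ _))

/-- Stopping a càglàd path at `T` restricts its Stieltjes measure to `[0, T)`. -/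
theorem stieltjesMeasure_comp_clip_of_leftCont {g : ℝ≥0 → ℝ} (hg : Monotone g) (h0 : g 0 = 0)
    (hc : ∀ t, ContinuousWithinAt g (Iic t) t) (T : ℝ≥0∞) (hg' : Monotone (g ∘ clip T))
    (h0' : (g ∘ clip T) 0 = 0) (hc' : ∀ t, ContinuousWithinAt (g ∘ clip T) (Iic t) t) :
    stieltjesMeasure hg' h0'.ge =
      (stieltjesMeasure hg h0.ge).restrict {s | ENNReal.ofReal s < T} := by
  induction T with
  | top =>
    have e : g ∘ clip ∞ = g := by rw [funext clip_top]; rfl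
    simpa using stieltjesMeasure_congr _ _ _ _ e
  | coe r =>
    -- For `r > 0` the set contains all negative `s`, since `ENNReal.ofReal` sends them to `0`; for
    -- `r = 0` it is empty.
    have e : ∀ u v : ℝ, Ico u v ∩ {s : ℝ | ENNReal.ofReal s < r} =
        if r = 0 then ∅ else Ico u (min v r) := by
      intro u v
      split_ifs with hr
      · simp [hr]
      · ext s
        have : 0 < (r : ℝ) := by exact_mod_cast pos_iff_ne_zero.2 hr
        have h : s.toNNReal < r ↔ s < r := by
          conv_lhs => rw [← Real.toNNReal_coe (r := r), Real.toNNReal_lt_toNNReal_iff this]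
        simp [ENNReal.ofReal, h, and_assoc]
    refine Measure.ext_of_Ico _ _ fun u v _ => ?_
    rw [Measure.restrict_apply measurableSet_Ico, e, stieltjesMeasure_Ico hg' h0' hc',
      extendZero_comp_clip, extendZero_comp_clip]
    split_ifs with hr
    · have hz : ∀ s : ℝ, extendZero g (min s (r : ℝ)) = 0 := by
        intro s
        unfold extendZero
        split_ifs with hs
        · rfl
        · rw [Real.toNNReal_of_nonpos (by simp [hr]), h0]
      simp [hz]
    · rw [stieltjesMeasure_Ico hg h0 hc]
      rcases le_total u r with hu | hu
      · rw [min_eq_left hu]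
      · rw [min_eq_right hu, ENNReal.ofReal_of_nonpos, ENNReal.ofReal_of_nonpos]
        · exact sub_nonpos.2 (monotone_extendZero hg h0.ge ((min_le_right _ _).trans hu))
        · exact sub_nonpos.2 (monotone_extendZero hg h0.ge (min_le_right _ _))

/-! ### Measurability of the ruin time. -/

/-- For deterministic conditions such as `q < t`, under which alone an event at time `q` is known at
time `t`. -/
theorem measurableSet_const_and {Ω : Type*} {m : MeasurableSpace Ω} {p : Prop} {s : Set Ω}
    (h : p → MeasurableSet[m] s) : MeasurableSet[m] {ω | p ∧ ω ∈ s} := by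
  by_cases hp : p
  · have e : {ω | p ∧ ω ∈ s} = s := by
      ext
      simp [hp]
    rw [e]
    exact h hp
  · have e : {ω | p ∧ ω ∈ s} = ∅ := by
      ext
      simp [hp]
    rw [e]
    exact @MeasurableSet.empty _ m

variable {Ω : Type*} [mΩ : MeasurableSpace Ω]

/-- Path properties hold only almost surely; completeness absorbs the exceptional set. -/
theorem UsualConditions.measurableSet_of_ae_iff {𝓕 : Filtration ℝ≥0 mΩ} {P : Measure Ω}
    (h : UsualConditions 𝓕 P) {t : ℝ≥0} {A B : Set Ω} (hA : MeasurableSet[𝓕 t] A)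
    (hAB : ∀ᵐ ω ∂P, ω ∈ B ↔ ω ∈ A) : MeasurableSet[𝓕 t] B := by
  have hnull : ∀ s : Set Ω, P s = 0 → MeasurableSet[𝓕 t] s := fun s hs =>
    𝓕.mono bot_le s (h.complete s hs)
  have hAB' : P {ω | ¬ (ω ∈ B ↔ ω ∈ A)} = 0 := ae_iff.1 hAB
  have e : B = (A \ {ω | ¬ (ω ∈ B ↔ ω ∈ A)}) ∪ (B ∩ {ω | ¬ (ω ∈ B ↔ ω ∈ A)}) := by
    ext ω
    simp only [mem_union, Set.mem_sdiff, mem_inter_iff, mem_ofPred_eq]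
    tauto
  rw [e]
  exact (hA.diff (hnull _ hAB')).union (hnull _ (measure_mono_null inter_subset_right hAB'))

namespace IsClaimPath

variable {μ : Measure (ℝ≥0 × (ℝ≥0 × ℝ))} {a b η y : ℝ} {N : ℝ≥0 → ℕ} {l : ℝ≥0 → ℝ}
  {Y : ℕ → ℝ}

theorem continuousWithinAt_sum_claims (h : IsClaimPath μ a b η y N l Y) (t : ℝ≥0) :
    ContinuousWithinAt (fun s => ∑ k ∈ Finset.range (N s), Y k) (Ici t) t := by
  refine (continuousWithinAt_const (b := ∑ k ∈ Finset.range (N t), Y k)).congr_of_eventuallyEq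
    ?_ rfl
  filter_upwards [eventually_nhdsGE_eq_of_continuousWithinAt_nat (h.rightCont t)] with s hs
  rw [hs]

theorem exists_tendsto_sum_claims (h : IsClaimPath μ a b η y N l Y) {t : ℝ≥0} (ht : 0 < t) :
    ∃ L, Tendsto (fun s => ∑ k ∈ Finset.range (N s), Y k) (𝓝[<] t) (𝓝 L) := by
  obtain ⟨n, hn⟩ := eventually_nhdsLT_eq_of_monotone_nat h.mono ht
  refine ⟨∑ k ∈ Finset.range n, Y k, tendsto_const_nhds.congr' ?_⟩
  filter_upwards [hn] with s hs
  rw [hs]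

end IsClaimPath

theorem preVal_eq_of_eventuallyEq {g₀ : ℝ} {g h : ℝ≥0 → ℝ} (hg : Monotone g) {t : ℝ≥0}
    (e : ∀ᶠ s in 𝓝[<] t, h s = g s) : preVal g₀ h t = preVal g₀ g t := by
  unfold preVal
  split_ifs with ht
  · rfl
  · have : (𝓝[<] t).NeBot := nhdsLT_neBot_of_exists_lt ⟨0, pos_iff_ne_zero.2 ht⟩
    exact leftLim_eq_of_tendsto ((hg.tendsto_leftLim t).congr' (e.mono fun s hs => hs.symm))

namespace Control

variable {𝓕 : Filtration ℝ≥0 mΩ} {P : Measure Ω} {π : Ω → Measure (ℝ≥0 × (ℝ≥0 × ℝ))}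
  {a b η y y' : ℝ}

section Paths

variable (α : Control 𝓕) (H : HawkesClaims 𝓕 P π a b η y) (c x : ℝ) {ω : Ω}
  (h : IsClaimPath (π ω) a b η y (fun t => H.N t ω) (fun t => H.lam t ω) (fun k => H.Y k ω))

include h

theorem continuousWithinAt_reserve (t : ℝ≥0) :
    ContinuousWithinAt (fun s => H.reserve c x s ω) (Ici t) t := by
  unfold HawkesClaims.reserve
  have hc : Continuous fun s : ℝ≥0 => x + c * (s : ℝ) := by fun_prop
  exact hc.continuousWithinAt.sub (h.continuousWithinAt_sum_claims t)

theorem rightLim_surplus (t : ℝ≥0) : Function.rightLim (fun s => α.surplus H c x s ω) t =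
    H.reserve c x t ω - α.Z t ω + Function.rightLim (fun s => α.K s ω) t := by
  refine rightLim_eq_of_tendsto ?_
  have hi : 𝓝[>] t ≤ 𝓝[≥] t := nhdsWithin_mono _ Ioi_subset_Ici_self
  exact (((continuousWithinAt_reserve H c x h t).mono_left hi).sub
    ((α.rightCont_Z ω t).mono_left hi)).add ((α.mono_K ω).tendsto_rightLim t)

/-- The right-hand side of the admissibility condition. -/
theorem preVal_surplus_add_jump (t : ℝ≥0) :
    preVal x (fun s => α.surplus H c x s ω) t +
      (H.reserve c 0 t ω - preVal 0 (fun s => H.reserve c 0 s ω) t) =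
    H.reserve c x t ω - preVal 0 (fun s => α.Z s ω) t + preVal 0 (fun s => α.K s ω) t := by
  have e : H.reserve c x t ω = x + H.reserve c 0 t ω := by
    simp only [HawkesClaims.reserve]
    ring
  rw [e]
  rcases eq_or_ne t 0 with rfl | ht
  · simp only [preVal, if_true]
    ring
  · have ht' : 0 < t := pos_iff_ne_zero.2 ht
    have : (𝓝[<] t).NeBot := nhdsLT_neBot_of_exists_lt ⟨0, ht'⟩
    obtain ⟨L, hL⟩ := h.exists_tendsto_sum_claims ht'
    have hc : Continuous fun s : ℝ≥0 => c * (s : ℝ) := by fun_prop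
    have hR : ∀ x : ℝ, Tendsto (fun s => H.reserve c x s ω) (𝓝[<] t) (𝓝 (x + c * t - L)) :=
      fun x => (((hc.tendsto t).mono_left nhdsWithin_le_nhds).const_add x).sub hL
    have hX := ((hR x).sub ((α.mono_Z ω).tendsto_leftLim t)).add ((α.mono_K ω).tendsto_leftLim t)
    have hX' : Tendsto (fun s => α.surplus H c x s ω) (𝓝[<] t) _ := hX
    simp only [preVal, if_neg ht]
    rw [leftLim_eq_of_tendsto hX', leftLim_eq_of_tendsto (hR 0)]
    ring

/-- Two dense times are needed because `R - Z` is right-continuous and `K` is not: the right limit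
of `K` is approximated by a later value, then `R - Z` is evaluated in between. Conversely, a later
value of `K` bounds its right limit. -/
theorem ruinTime_lt_iff (t : ℝ≥0) : α.ruinTime H c x ω < t ↔
    ∃ m n, TopologicalSpace.denseSeq ℝ≥0 m < TopologicalSpace.denseSeq ℝ≥0 n ∧
      TopologicalSpace.denseSeq ℝ≥0 n < t ∧
      H.reserve c x (TopologicalSpace.denseSeq ℝ≥0 m) ω -
        α.Z (TopologicalSpace.denseSeq ℝ≥0 m) ω + α.K (TopologicalSpace.denseSeq ℝ≥0 n) ω < 0 := by
  have hdense := TopologicalSpace.denseRange_denseSeq ℝ≥0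
  constructor
  · intro hlt
    obtain ⟨s, hs⟩ := iInf_lt_iff.1 hlt
    obtain ⟨hruin, hst⟩ := iInf_lt_iff.1 hs
    rw [rightLim_surplus α H c x h] at hruin
    have hst : s < t := by exact_mod_cast hst
    have hK := ((α.mono_K ω).tendsto_rightLim s).const_add (H.reserve c x s ω - α.Z s ω)
    obtain ⟨u, hu, hsub⟩ := (mem_nhdsGT_iff_exists_Ioo_subset' hst).1
      ((hK.eventually (gt_mem_nhds hruin)).and (Ioo_mem_nhdsGT hst))
    obtain ⟨_, ⟨n, rfl⟩, hn⟩ := hdense.exists_between (show s < u from hu)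
    obtain ⟨hneg, hlt⟩ := hsub hn
    have hRZ : Tendsto (fun q => H.reserve c x q ω - α.Z q ω +
        α.K (TopologicalSpace.denseSeq ℝ≥0 n) ω) (𝓝[≥] s) _ :=
      (((continuousWithinAt_reserve H c x h s)).sub (α.rightCont_Z ω s)).add_const _
    obtain ⟨v, hv, hsub'⟩ := (mem_nhdsGE_iff_exists_Ico_subset' hlt.1).1
      (hRZ.eventually (gt_mem_nhds hneg))
    obtain ⟨_, ⟨m, rfl⟩, hm⟩ := hdense.exists_between
      (show s < min v (TopologicalSpace.denseSeq ℝ≥0 n) from lt_min hv hlt.1)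
    exact ⟨m, n, hm.2.trans_le (min_le_right _ _), hlt.2,
      hsub' ⟨hm.1.le, hm.2.trans_le (min_le_left _ _)⟩⟩
  · rintro ⟨m, n, hmn, hnt, hneg⟩
    refine lt_of_le_of_lt (iInf₂_le (TopologicalSpace.denseSeq ℝ≥0 m) ?_)
      (ENNReal.coe_lt_coe.2 (hmn.trans hnt))
    rw [rightLim_surplus α H c x h]
    linarith [(α.mono_K ω).rightLim_le hmn]

end Paths

/-- Being before `t`, the ruin time is known at time `t`. -/
theorem measurableSet_ruinTime_lt (h𝓕 : UsualConditions 𝓕 P) (α : Control 𝓕)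
    (H : HawkesClaims 𝓕 P π a b η y) (c x : ℝ) (t : ℝ≥0) :
    MeasurableSet[𝓕 t] {ω | α.ruinTime H c x ω < t} := by
  have hmeas : MeasurableSet[𝓕 t] (⋃ m, ⋃ n, {ω |
      TopologicalSpace.denseSeq ℝ≥0 m < TopologicalSpace.denseSeq ℝ≥0 n ∧
      TopologicalSpace.denseSeq ℝ≥0 n < t ∧
      H.reserve c x (TopologicalSpace.denseSeq ℝ≥0 m) ω -
        α.Z (TopologicalSpace.denseSeq ℝ≥0 m) ω +
          α.K (TopologicalSpace.denseSeq ℝ≥0 n) ω < 0}) := by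
    refine MeasurableSet.iUnion fun m => MeasurableSet.iUnion fun n => ?_
    generalize TopologicalSpace.denseSeq ℝ≥0 m = q
    generalize TopologicalSpace.denseSeq ℝ≥0 n = r
    refine measurableSet_const_and (s := {ω | r < t ∧ H.reserve c x q ω - α.Z q ω + α.K r ω < 0})
      fun hqr => measurableSet_const_and
        (s := {ω | H.reserve c x q ω - α.Z q ω + α.K r ω < 0}) fun hrt => ?_
    have hq : 𝓕 q ≤ 𝓕 t := 𝓕.mono (hqr.trans hrt).le
    have h1 : Measurable[𝓕 t] fun ω => H.reserve c x q ω :=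
      ((H.adapted_claims q).mono hq le_rfl).const_sub (x + c * q)
    have h2 : Measurable[𝓕 t] fun ω => H.reserve c x q ω - α.Z q ω + α.K r ω :=
      (h1.sub ((α.adapted_Z q).mono hq le_rfl)).add
        ((α.adapted_K r).mono (𝓕.mono hrt.le) le_rfl)
    exact h2 measurableSet_Iio
  refine h𝓕.measurableSet_of_ae_iff hmeas ?_
  filter_upwards [H.ae_isClaimPath] with ω hω
  refine (ruinTime_lt_iff α H c x hω t).trans ?_
  simp

/-! ### Adaptedness of stopped controls. -/

/-- By right-continuity and monotonicity, when `T < t` a value of `Z` at `T` below `z` is detected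
at dense times just above `T`. -/
theorem measurable_Z_clip (α : Control 𝓕) {T : Ω → ℝ≥0∞}
    (hT : ∀ t : ℝ≥0, MeasurableSet[𝓕 t] {ω | T ω < t}) (t : ℝ≥0) :
    Measurable[𝓕 t] fun ω => α.Z (clip (T ω) t) ω := by
  refine measurable_of_Iio (mδ := 𝓕 t) fun z => ?_
  have e : (fun ω => α.Z (clip (T ω) t) ω) ⁻¹' Iio z = {ω | α.Z t ω < z} ∪
      ⋃ n, {ω | TopologicalSpace.denseSeq ℝ≥0 n < t ∧
        T ω < TopologicalSpace.denseSeq ℝ≥0 n ∧ α.Z (TopologicalSpace.denseSeq ℝ≥0 n) ω < z} := by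
    ext ω
    simp only [mem_preimage, mem_Iio, mem_union, mem_ofPred_eq, mem_iUnion]
    constructor
    · intro hz
      rcases le_or_gt (t : ℝ≥0∞) (T ω) with hle | hlt
      · exact Or.inl (by rwa [clip_of_le hle] at hz)
      · right
        rw [clip_of_ge hlt.le] at hz
        have hr : ((T ω).toNNReal : ℝ≥0∞) = T ω := ENNReal.coe_toNNReal hlt.ne_top
        rw [← hr] at hlt ⊢
        rw [ENNReal.coe_lt_coe] at hlt
        obtain ⟨u, hu, hsub⟩ := (mem_nhdsGE_iff_exists_Ico_subset' hlt).1
          ((α.rightCont_Z ω (T ω).toNNReal).eventually (gt_mem_nhds hz))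
        obtain ⟨_, ⟨n, rfl⟩, hn⟩ := (TopologicalSpace.denseRange_denseSeq ℝ≥0).exists_between
          (show (T ω).toNNReal < min u t from lt_min hu hlt)
        exact ⟨n, hn.2.trans_le (min_le_right _ _), ENNReal.coe_lt_coe.2 hn.1,
          hsub ⟨hn.1.le, hn.2.trans_le (min_le_left _ _)⟩⟩
    · rintro (hz | ⟨n, hnt, hTn, hz⟩)
      · refine (α.mono_Z ω ?_).trans_lt hz
        exact ENNReal.coe_le_coe.1 ((ENNReal.coe_toNNReal_le_self).trans (min_le_left _ _))
      · refine (α.mono_Z ω ?_).trans_lt hz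
        rw [clip_of_ge (hTn.le.trans (ENNReal.coe_le_coe.2 hnt.le))]
        exact ENNReal.coe_le_coe.1 (ENNReal.coe_toNNReal_le_self.trans hTn.le)
  rw [e]
  refine (α.adapted_Z t measurableSet_Iio).union (MeasurableSet.iUnion fun n => ?_)
  generalize TopologicalSpace.denseSeq ℝ≥0 n = q
  exact measurableSet_const_and (s := {ω | T ω < q ∧ α.Z q ω < z}) fun hq =>
    𝓕.mono hq.le _ ((hT q).inter (α.adapted_Z q (measurableSet_Iio (a := z))))

/-- By left-continuity, when `0 < T < t` a value of `K` at `T` above `z` is detected at dense times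
just below `T`; at `T = 0` no such time exists, hence the separate event for `α.K 0`. -/
theorem measurable_K_clip (α : Control 𝓕) {T : Ω → ℝ≥0∞}
    (hT : ∀ t : ℝ≥0, MeasurableSet[𝓕 t] {ω | T ω < t}) (t : ℝ≥0) :
    Measurable[𝓕 t] fun ω => α.K (clip (T ω) t) ω := by
  refine measurable_of_Ioi (mδ := 𝓕 t) fun z => ?_
  have e : (fun ω => α.K (clip (T ω) t) ω) ⁻¹' Ioi z =
      ({ω | z < α.K 0 ω} ∪ ({ω | T ω < t}ᶜ ∩ {ω | z < α.K t ω})) ∪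
      ⋃ n, {ω | TopologicalSpace.denseSeq ℝ≥0 n < t ∧
        ¬ T ω < TopologicalSpace.denseSeq ℝ≥0 n ∧
          z < α.K (TopologicalSpace.denseSeq ℝ≥0 n) ω} := by
    ext ω
    simp only [mem_preimage, mem_Ioi, mem_union, mem_ofPred_eq, mem_iUnion, mem_inter_iff,
      mem_compl_iff]
    constructor
    · intro hz
      rcases le_or_gt (t : ℝ≥0∞) (T ω) with hle | hlt
      · exact Or.inl (Or.inr ⟨not_lt.2 hle, by rwa [clip_of_le hle] at hz⟩)
      · rw [clip_of_ge hlt.le] at hz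
        rcases eq_or_ne (T ω).toNNReal 0 with h0 | h0
        · exact Or.inl (Or.inl (by rwa [h0] at hz))
        · right
          have hr : ((T ω).toNNReal : ℝ≥0∞) = T ω := ENNReal.coe_toNNReal hlt.ne_top
          rw [← hr] at hlt ⊢
          rw [ENNReal.coe_lt_coe] at hlt
          obtain ⟨u, hu, hsub⟩ := (mem_nhdsLE_iff_exists_Ioc_subset' (pos_iff_ne_zero.2 h0)).1
            ((α.leftCont_K ω (T ω).toNNReal).eventually (lt_mem_nhds hz))
          obtain ⟨_, ⟨n, rfl⟩, hn⟩ := (TopologicalSpace.denseRange_denseSeq ℝ≥0).exists_between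
            (show u < (T ω).toNNReal from hu)
          exact ⟨n, hn.2.trans hlt, not_lt.2 (ENNReal.coe_le_coe.2 hn.2.le), hsub ⟨hn.1, hn.2.le⟩⟩
    · rintro ((hz | ⟨hle, hz⟩) | ⟨n, hnt, hTn, hz⟩)
      · exact hz.trans_le (α.mono_K ω bot_le)
      · rwa [clip_of_le (not_lt.1 hle)]
      · refine hz.trans_le (α.mono_K ω ?_)
        conv_lhs => rw [← clip_of_le (not_lt.1 hTn)]
        exact monotone_clip _ hnt.le
  rw [e]
  refine ((𝓕.mono bot_le _ (α.adapted_K 0 measurableSet_Ioi)).union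
    ((hT t).compl.inter (α.adapted_K t measurableSet_Ioi))).union (MeasurableSet.iUnion fun n => ?_)
  generalize TopologicalSpace.denseSeq ℝ≥0 n = q
  exact measurableSet_const_and (s := {ω | ¬ T ω < q ∧ z < α.K q ω}) fun hq =>
    𝓕.mono hq.le _ ((hT q).compl.inter (α.adapted_K q (measurableSet_Ioi (a := z))))

/-- The control `α` stopped at the random time `T`. -/
noncomputable def stopped (α : Control 𝓕) (T : Ω → ℝ≥0∞)
    (hT : ∀ t : ℝ≥0, MeasurableSet[𝓕 t] {ω | T ω < t}) : Control 𝓕 where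
  Z t ω := α.Z (clip (T ω) t) ω
  K t ω := α.K (clip (T ω) t) ω
  adapted_Z := α.measurable_Z_clip hT
  adapted_K := α.measurable_K_clip hT
  mono_Z ω := (α.mono_Z ω).comp (monotone_clip _)
  mono_K ω := (α.mono_K ω).comp (monotone_clip _)
  rightCont_Z ω t := (α.rightCont_Z ω _).comp (continuous_clip (T ω)).continuousWithinAt
    fun _ hs => monotone_clip _ hs
  leftCont_K ω t := (α.leftCont_K ω _).comp (continuous_clip (T ω)).continuousWithinAt
    fun _ hs => monotone_clip _ hs
  zero_le_Z ω := (α.zero_le_Z ω).trans (α.mono_Z ω bot_le)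
  K_zero ω := by rw [clip_of_le (by simp), α.K_zero]

/-! ### Comparing a control with its stopped version. -/

variable (α : Control 𝓕) {T : Ω → ℝ≥0∞} (hT : ∀ t : ℝ≥0, MeasurableSet[𝓕 t] {ω | T ω < t})

/-- Stopping a control and replacing the reserve by a larger one preserves admissibility. -/
theorem Admissible.stopped {α : Control 𝓕} {H : HawkesClaims 𝓕 P π a b η y}
    {H' : HawkesClaims 𝓕 P π a b η y'} {c x : ℝ} (hα : α.Admissible H' c x)
    (hR : ∀ᵐ ω ∂P, ∀ t, H'.reserve c x t ω ≤ H.reserve c x t ω) :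
    (α.stopped T hT).Admissible H c x := by
  filter_upwards [hα, hR, H.ae_isClaimPath, H'.ae_isClaimPath] with ω hω hRω hp hp' t
  have hωt := hω t
  -- In this form the bound involves the reserve only through its value at `t`, so it increases with
  -- the reserve.
  rw [preVal_surplus_add_jump _ _ _ _ hp'] at hωt
  rw [preVal_surplus_add_jump _ _ _ _ hp]
  rcases le_or_gt (t : ℝ≥0∞) (T ω) with hle | hlt
  · have hev : ∀ᶠ s in 𝓝[<] t, clip (T ω) s = s := eventually_nhdsWithin_of_forall fun s hs =>
      clip_of_le ((ENNReal.coe_le_coe.2 (le_of_lt hs)).trans hle)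
    have eZ : preVal 0 (fun s => (α.stopped T hT).Z s ω) t = preVal 0 (fun s => α.Z s ω) t :=
      preVal_eq_of_eventuallyEq (α.mono_Z ω) (hev.mono fun s hs => by simp [Control.stopped, hs])
    have eK : preVal 0 (fun s => (α.stopped T hT).K s ω) t = preVal 0 (fun s => α.K s ω) t :=
      preVal_eq_of_eventuallyEq (α.mono_K ω) (hev.mono fun s hs => by simp [Control.stopped, hs])
    have eZt : (α.stopped T hT).Z t ω = α.Z t ω := by simp [Control.stopped, clip_of_le hle]
    rw [eZ, eK, eZt]
    refine hωt.trans (max_le_max_left 0 ?_)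
    linarith [hRω t]
  -- After `T` the stopped dividends are constant, so their jump is zero.
  · have hr : ((T ω).toNNReal : ℝ≥0∞) = T ω := ENNReal.coe_toNNReal hlt.ne_top
    have hlt' : (T ω).toNNReal < t := by rwa [← ENNReal.coe_lt_coe, hr]
    have hev : ∀ᶠ s in 𝓝[<] t, (α.stopped T hT).Z s ω = α.Z (T ω).toNNReal ω := by
      filter_upwards [Ioo_mem_nhdsLT hlt'] with s hs
      have : T ω ≤ s := by rw [← hr]; exact ENNReal.coe_le_coe.2 hs.1.le
      simp [Control.stopped, clip_of_ge this]
    have hpos : 0 < t := bot_le.trans_lt hlt'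
    have : (𝓝[<] t).NeBot := nhdsLT_neBot_of_exists_lt ⟨0, hpos⟩
    have eZ : preVal 0 (fun s => (α.stopped T hT).Z s ω) t = α.Z (T ω).toNNReal ω := by
      rw [preVal, if_neg hpos.ne']
      exact leftLim_eq_of_tendsto (tendsto_const_nhds.congr' (hev.mono fun s hs => hs.symm))
    have eZt : (α.stopped T hT).Z t ω = α.Z (T ω).toNNReal ω := by
      simp [Control.stopped, clip_of_ge hlt.le]
    rw [eZ, eZt, sub_self]
    exact le_max_left _ _

/-- A control stopped at ruin is not ruined earlier by a larger reserve. -/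
theorem ruinTime_le_ruinTime_stopped {H : HawkesClaims 𝓕 P π a b η y}
    {H' : HawkesClaims 𝓕 P π a b η y'} {c x : ℝ} {ω : Ω}
    (hp : IsClaimPath (π ω) a b η y (fun t => H.N t ω) (fun t => H.lam t ω) (fun k => H.Y k ω))
    (hp' : IsClaimPath (π ω) a b η y' (fun t => H'.N t ω) (fun t => H'.lam t ω)
      (fun k => H'.Y k ω))
    (hTω : T ω = α.ruinTime H' c x ω) (hR : ∀ t, H'.reserve c x t ω ≤ H.reserve c x t ω) :
    α.ruinTime H' c x ω ≤ (α.stopped T hT).ruinTime H c x ω := by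
  refine le_iInf₂ fun t ht => ?_
  by_contra! hlt
  refine absurd hlt (not_lt.2 (iInf₂_le t ?_))
  rw [rightLim_surplus _ _ _ _ hp] at ht
  rw [rightLim_surplus _ _ _ _ hp']
  rw [← hTω] at hlt
  have eZ : (α.stopped T hT).Z t ω = α.Z t ω := by simp [stopped, clip_of_le hlt.le]
  -- The inequality `t < T` must be strict: a right limit looks past `t`, and at `T` itself the
  -- stopped `K` loses its jump.
  have hev : ∀ᶠ s in 𝓝[>] t, α.K s ω = (α.stopped T hT).K s ω := by
    have : ∀ᶠ s : ℝ≥0 in 𝓝 t, (s : ℝ≥0∞) < T ω :=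
      ENNReal.continuous_coe.continuousAt.eventually (gt_mem_nhds hlt)
    filter_upwards [nhdsWithin_le_nhds this] with s hs
    simp [stopped, clip_of_le hs.le]
  have eK : Function.rightLim (fun s => (α.stopped T hT).K s ω) t =
      Function.rightLim (fun s => α.K s ω) t :=
    rightLim_eq_of_tendsto (((α.mono_K ω).tendsto_rightLim t).congr' hev)
  rw [eZ, eK] at ht
  linarith [hR t]

/-- The stopped dividend measure is the original one on `[0, T]`, and ruin not before `T` means all
of it counts. -/
theorem discountedDividends_le_stopped {H : HawkesClaims 𝓕 P π a b η y}
    {H' : HawkesClaims 𝓕 P π a b η y'} {c ρ x : ℝ} {ω : Ω}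
    (hTω : T ω = α.ruinTime H' c x ω)
    (hle : α.ruinTime H' c x ω ≤ (α.stopped T hT).ruinTime H c x ω) :
    α.discountedDividends H' c ρ x ω ≤ (α.stopped T hT).discountedDividends H c ρ x ω := by
  unfold discountedDividends
  have e : stieltjesMeasure ((α.stopped T hT).mono_Z ω) ((α.stopped T hT).zero_le_Z ω) = _ :=
    stieltjesMeasure_comp_clip_of_rightCont (α.mono_Z ω) (α.zero_le_Z ω) (α.rightCont_Z ω) (T ω)
      ((α.stopped T hT).mono_Z ω) ((α.stopped T hT).zero_le_Z ω) ((α.stopped T hT).rightCont_Z ω)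
  have hm : MeasurableSet {s : ℝ | 0 ≤ s ∧
      ENNReal.ofReal s ≤ (α.stopped T hT).ruinTime H c x ω} :=
    measurableSet_Ici.inter (ENNReal.measurable_ofReal measurableSet_Iic)
  rw [e, Measure.restrict_restrict hm]
  exact lintegral_mono_set fun s hs => ⟨⟨hs.1, hs.2.trans hle⟩, hs.2.trans hTω.ge⟩

/-- The stopped injection measure already lives on `[0, T)`, so the new ruin time is irrelevant. -/
theorem discountedInjections_stopped_le {H : HawkesClaims 𝓕 P π a b η y}
    {H' : HawkesClaims 𝓕 P π a b η y'} {c ρ x : ℝ} {ω : Ω}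
    (hTω : T ω = α.ruinTime H' c x ω) :
    (α.stopped T hT).discountedInjections H c ρ x ω ≤ α.discountedInjections H' c ρ x ω := by
  unfold discountedInjections
  have e : stieltjesMeasure ((α.stopped T hT).mono_K ω) ((α.stopped T hT).K_zero ω).ge = _ :=
    stieltjesMeasure_comp_clip_of_leftCont (α.mono_K ω) (α.K_zero ω) (α.leftCont_K ω) (T ω)
      ((α.stopped T hT).mono_K ω) ((α.stopped T hT).K_zero ω) ((α.stopped T hT).leftCont_K ω)
  have hm : MeasurableSet {s : ℝ | 0 ≤ s ∧
      ENNReal.ofReal s < (α.stopped T hT).ruinTime H c x ω} :=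
    measurableSet_Ici.inter (ENNReal.measurable_ofReal measurableSet_Iio)
  rw [e, Measure.restrict_restrict hm]
  exact lintegral_mono_set fun s hs => ⟨hs.1.1, lt_of_lt_of_eq hs.2 hTω⟩

end Control

/-! ### Comparison of value functions. -/

theorem valueFunction_le_of_reserve_le {𝓕 : Filtration ℝ≥0 mΩ} {P : Measure Ω}
    {π : Ω → Measure (ℝ≥0 × (ℝ≥0 × ℝ))} {a b η y y' : ℝ} (h𝓕 : UsualConditions 𝓕 P)
    (H : HawkesClaims 𝓕 P π a b η y) (H' : HawkesClaims 𝓕 P π a b η y') (c ρ δ x : ℝ)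
    (hR : ∀ᵐ ω ∂P, ∀ t, H'.reserve c x t ω ≤ H.reserve c x t ω) :
    valueFunction H' c ρ δ x ≤ valueFunction H c ρ δ x := by
  refine iSup₂_le fun α hα => ?_
  have hT := α.measurableSet_ruinTime_lt h𝓕 H' c x
  refine le_trans ?_ (le_iSup₂ (α.stopped (α.ruinTime H' c x) hT) (hα.stopped hT hR))
  -- Subtraction in `EReal` is monotone even at infinite values, so the two expectations are
  -- compared separately, without integrability.
  refine EReal.sub_le_sub ?_ ?_
  · refine EReal.coe_ennreal_le_coe_ennreal_iff.2 (lintegral_mono_ae ?_)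
    filter_upwards [hR, H.ae_isClaimPath, H'.ae_isClaimPath] with ω hω hp hp'
    exact α.discountedDividends_le_stopped hT rfl (α.ruinTime_le_ruinTime_stopped hT hp hp' rfl hω)
  · refine EReal.coe_ennreal_le_coe_ennreal_iff.2 ?_
    gcongr with ω
    exact α.discountedInjections_stopped_le hT rfl

end HawkesDividend

open HawkesDividend in
theorem mainTheorem6 {Ω : Type*} [mΩ : MeasurableSpace Ω]
    (P : Measure Ω) [IsProbabilityMeasure P]
    (𝓕 : Filtration ℝ≥0 mΩ) (h𝓕 : UsualConditions 𝓕 P)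
    (a b η c ρ δ : ℝ) (ha : 0 < a) (hb : 0 < b) (hη : 0 < η) (hc : 0 < c) (hρ : 0 < ρ)
    (hδ : 1 < δ)
    (f : ℝ → ℝ) (hf : IsPositiveDensity f)
    (π : Ω → Measure (ℝ≥0 × (ℝ≥0 × ℝ)))
    (hπ : IsPoissonRandomMeasure 𝓕 P (claimIntensity f) π)
    (H : ∀ y : Set.Ici b, HawkesClaims 𝓕 P π a b η (y : ℝ))
    (x : ℝ) (hx : 0 ≤ x) :
    Antitone fun y : Set.Ici b => valueFunction (H y) c ρ δ x := by
  intro y y' hy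
  refine valueFunction_le_of_reserve_le h𝓕 (H y) (H y') c ρ δ x ?_
  have hmeas : MeasurableSet {p : ℝ≥0 × (ℝ≥0 × ℝ) | p.2.2 ≤ 0} :=
    (measurable_snd.comp measurable_snd) measurableSet_Iic
  filter_upwards [(H y).ae_isClaimPath, (H y').ae_isClaimPath,
    hπ.ae_eq_zero hmeas (claimIntensity_nonpos hf)] with ω h h' hμ t
  exact sub_le_sub_left (h.sum_claims_le h' ha.le hη.le hy hμ t) _
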